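/- Let $G$ be a countably infinite set and let $W=(W_{ij})_{i,j\in G}$ be a real symmetric matrix (the weighted adjacency operator of an undirected graph on $G$ in which $j$ is a neighbour of $i$ when $W_{ij}\neq 0$). Assume that the maximal number of neighbours $\deg$ of a vertex is finite and that $|W_{ij}|\le 1/\deg$ for all $i,j$. Then $(Wu)_i=\sum_j W_{ij}u_j$ defines a bounded self-adjoint operator on $\ell^2(G)$ with norm at most $1$. Let $\operatorname{Sp}(W)\subset[-1,1]$ be its spectrum, $E$ its resolution of the identity, and, for $i\in G$, let $\mu_{ii}(\omega)=\langle E(\omega)\delta_i,\delta_i\rangle$ be the spectral measure of $W$ at the unit vector $\delta_i$, a probability measure on $\operatorname{Sp}(W)$. For a continuous function $f$ on $\operatorname{Sp}(W)$ let $\mathcal K(f)=f(W)=\int f\,dE$. For a function $f$ with an expansion $f(x)=\sum_{k\ge 0}f_kx^k$ on $\operatorname{Sp}(W)$ let $\alpha(f)=\sum_{k\ge 0}|f_k|(k+1)\in[0,\infty]$ (the infimum over all such expansions if the coefficients are not unique; $\alpha(f)=\infty$ if there is none). For $\rho>0$ let $\mathcal F_\rho$ be the set of positive real-analytic functions $g$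 on the convex hull of $\operatorname{Sp}(W)$ such that $\alpha(\log g)\le\rho$. Let $(G_n)_{n\in\mathbb N}$ be a nested sequence of finite subsets of $G$, $G_n\subset G_{n+1}$, let $m_n=\operatorname{Card}(G_n)$, let $\delta_n=\operatorname{Card}\{i\in G_n:\ \exists j\in G\setminus G_n,\ W_{ij}\ne 0\}$, and let $\mathcal K_n(f)=(\mathcal K(f)_{ij})_{i,j\in G_n}$. Assume that 1. $\delta_n=o(m_n)$ as $n\to\infty$; 2. there is a finite positive measure $\mu$ on $\operatorname{Sp}(W)$ such that $\frac1{m_n}\sum_{i\in G_n}\mu_{ii}$ converges to $\mu$ in distribution (weakly). Then for every $\rho>0$ and every $g\in\mathcal F_\rho$ the determinants $\det\mathcal K_n(g)$ are positive, $\log g$ is $\mu$-integrable, and $$\frac1{m_n}\log\det\mathcal K_n(g)\ \xrightarrow[n\to\infty]{}\ \int\log g\,d\mu .$$ -/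

import Mathlib

open MeasureTheory Filter Topology
open scoped ENNReal NNReal CompactlySupported InnerProductSpace

noncomputable section

/-- An undirected weighted graph on the vertex set `G`, of bounded degree, with renormalized
weights: `W` is symmetric, `i` and `j` are neighbors when `W i j ≠ 0`, the maximal number of
neighbors `deg` is finite, and the entries of `W` lie in `[-1/deg, 1/deg]`. -/
structure WeightedGraph (G : Type*) where
  W : G → G → ℝ
  symm : ∀ i j, W i j = W j i
  deg_lt_top : (⨆ i, {j | W i j ≠ 0}.encard) < ⊤
  abs_le : ∀ i j, |W i j| ≤ 1 / ((⨆ i, {j | W i j ≠ 0}.encard).toNat : ℝ)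

/-- The Hilbert space `ℓ²(G)` of square summable families, with complex scalars so that spectra
and the functional calculus are available. -/
def ell2 (G : Type*) : Type _ := lp (fun _ : G => ℂ) 2

namespace ell2

variable {G : Type*}

instance : NormedAddCommGroup (ell2 G) :=
  inferInstanceAs (NormedAddCommGroup (lp (fun _ : G => ℂ) 2))

instance : InnerProductSpace ℂ (ell2 G) :=
  inferInstanceAs (InnerProductSpace ℂ (lp (fun _ : G => ℂ) 2))

instance : CompleteSpace (ell2 G) :=
  inferInstanceAs (CompleteSpace (lp (fun _ : G => ℂ) 2))

instance : CoeFun (ell2 G) fun _ => G → ℂ := ⟨fun u => Subtype.val u⟩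

@[ext]
lemma ext {u v : ell2 G} (h : ∀ i, u i = v i) : u = v := Subtype.ext (funext h)

lemma add_apply (u v : ell2 G) (i : G) : (u + v) i = u i + v i := rfl

lemma smul_apply (c : ℂ) (u : ell2 G) (i : G) : (c • u) i = c * u i := rfl

/-- The sequence `δ_i = (1_{k = i})_k` in `ℓ²(G)`. -/
def delta (i : G) : ell2 G :=
  open Classical in (lp.single 2 i (1 : ℂ) : lp (fun _ : G => ℂ) 2)

lemma delta_apply (i k : G) [Decidable (k = i)] : delta i k = if k = i then 1 else 0 := by
  classical
  have h := lp.single_apply (E := fun _ : G => ℂ) 2 i (1 : ℂ) k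
  rw [Pi.single_apply] at h
  refine Eq.trans ?_ (h.trans ?_)
  · unfold delta
    congr!
  · congr

lemma inner_delta (i : G) (u : ell2 G) : ⟪delta i, u⟫_ℂ = u i := by
  classical
  have h := lp.inner_single_left (𝕜 := ℂ) i (1 : ℂ) (show lp (fun _ : G => ℂ) 2 from u)
  refine Eq.trans ?_ (h.trans ?_)
  · unfold delta
    congr!
  · simp

end ell2

open ell2

namespace WeightedGraph

variable {G : Type*} (Γ : WeightedGraph G)

/-- The degree of the graph: the maximal number of neighbors of a vertex. -/
def deg : ℕ := (⨆ i, {j | Γ.W i j ≠ 0}.encard).toNat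

lemma encard_le_deg (i : G) : {j | Γ.W i j ≠ 0}.encard ≤ (Γ.deg : ℕ∞) := by
  have h : ((⨆ i, {j | Γ.W i j ≠ 0}.encard).toNat : ℕ∞) = ⨆ i, {j | Γ.W i j ≠ 0}.encard :=
    ENat.natCast_toNat Γ.deg_lt_top.ne
  rw [deg, h]
  exact le_iSup (fun i => {j | Γ.W i j ≠ 0}.encard) i

lemma finite_neighbors (i : G) : {j | Γ.W i j ≠ 0}.Finite :=
  Set.finite_of_encard_le_coe (Γ.encard_le_deg i)

lemma sum_abs_le_one (i : G) (s : Finset G) : ∑ j ∈ s, |Γ.W i j| ≤ 1 := by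
  classical
  have h1 : ∑ j ∈ s, |Γ.W i j| = ∑ j ∈ s with Γ.W i j ≠ 0, |Γ.W i j| := by
    rw [Finset.sum_filter_of_ne]
    intro j _ hj h0
    exact hj (by simp [h0])
  have hcard : (s.filter fun j => Γ.W i j ≠ 0).card ≤ Γ.deg := by
    have h2 : ((s.filter fun j => Γ.W i j ≠ 0 : Finset G) : Set G).encard ≤ (Γ.deg : ℕ∞) :=
      (Set.encard_le_encard (by intro j hj; simpa using (by simpa using hj : j ∈ s ∧ _).2)).trans
        (Γ.encard_le_deg i)
    rw [Set.encard_coe_eq_coe_finsetCard] at h2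
    exact_mod_cast h2
  rw [h1]
  calc ∑ j ∈ s with Γ.W i j ≠ 0, |Γ.W i j|
      ≤ (s.filter fun j => Γ.W i j ≠ 0).card • (1 / (Γ.deg : ℝ)) :=
        Finset.sum_le_card_nsmul _ _ _ fun j _ => Γ.abs_le i j
    _ ≤ Γ.deg • (1 / (Γ.deg : ℝ)) := by
        gcongr
    _ ≤ 1 := by
        rw [nsmul_eq_mul, mul_one_div]
        exact div_self_le_one _

lemma tsum_row (i : G) (u : G → ℂ) :
    ∑' j, (Γ.W i j : ℂ) * u j = ∑ j ∈ (Γ.finite_neighbors i).toFinset, (Γ.W i j : ℂ) * u j :=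
  tsum_eq_sum fun j hj => by
    have : Γ.W i j = 0 := by simpa using hj
    simp [this]

lemma norm_row_sq_le (i : G) (u : G → ℂ) :
    ‖∑' j, (Γ.W i j : ℂ) * u j‖ ^ 2
      ≤ ∑ j ∈ (Γ.finite_neighbors i).toFinset, |Γ.W i j| * ‖u j‖ ^ 2 := by
  rw [tsum_row]
  set N := (Γ.finite_neighbors i).toFinset
  have h1 : ‖∑ j ∈ N, (Γ.W i j : ℂ) * u j‖ ≤ ∑ j ∈ N, √|Γ.W i j| * (√|Γ.W i j| * ‖u j‖) := by
    refine (norm_sum_le _ _).trans (Finset.sum_le_sum fun j _ => ?_)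
    rw [norm_mul, Complex.norm_real, Real.norm_eq_abs, ← mul_assoc,
      Real.mul_self_sqrt (abs_nonneg _)]
  calc ‖∑ j ∈ N, (Γ.W i j : ℂ) * u j‖ ^ 2
      ≤ (∑ j ∈ N, √|Γ.W i j| * (√|Γ.W i j| * ‖u j‖)) ^ 2 := by gcongr
    _ ≤ (∑ j ∈ N, √|Γ.W i j| ^ 2) * ∑ j ∈ N, (√|Γ.W i j| * ‖u j‖) ^ 2 :=
        Finset.sum_mul_sq_le_sq_mul_sq _ _ _
    _ = (∑ j ∈ N, |Γ.W i j|) * ∑ j ∈ N, |Γ.W i j| * ‖u j‖ ^ 2 := by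
        simp only [mul_pow, Real.sq_sqrt (abs_nonneg _)]
    _ ≤ 1 * ∑ j ∈ N, |Γ.W i j| * ‖u j‖ ^ 2 := by
        gcongr
        exact Γ.sum_abs_le_one i N
    _ = _ := one_mul _

lemma sum_norm_row_sq_le (u : ell2 G) (s : Finset G) :
    ∑ i ∈ s, ‖∑' j, (Γ.W i j : ℂ) * u j‖ ^ 2 ≤ ‖u‖ ^ 2 := by
  classical
  set T := s.biUnion fun i => (Γ.finite_neighbors i).toFinset
  calc ∑ i ∈ s, ‖∑' j, (Γ.W i j : ℂ) * u j‖ ^ 2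
      ≤ ∑ i ∈ s, ∑ j ∈ (Γ.finite_neighbors i).toFinset, |Γ.W i j| * ‖u j‖ ^ 2 :=
        Finset.sum_le_sum fun i _ => Γ.norm_row_sq_le i u
    _ ≤ ∑ i ∈ s, ∑ j ∈ T, |Γ.W i j| * ‖u j‖ ^ 2 :=
        Finset.sum_le_sum fun i hi => Finset.sum_le_sum_of_subset_of_nonneg
          (Finset.subset_biUnion_of_mem (fun i => (Γ.finite_neighbors i).toFinset) hi)
          fun j _ _ => by positivity
    _ = ∑ j ∈ T, (∑ i ∈ s, |Γ.W j i|) * ‖u j‖ ^ 2 := by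
        rw [Finset.sum_comm]
        refine Finset.sum_congr rfl fun j _ => ?_
        rw [Finset.sum_mul]
        exact Finset.sum_congr rfl fun i _ => by rw [Γ.symm i j]
    _ ≤ ∑ j ∈ T, 1 * ‖u j‖ ^ 2 := by
        gcongr with j _
        exact Γ.sum_abs_le_one j s
    _ ≤ ‖u‖ ^ 2 := by
        have h := lp.sum_rpow_le_norm_rpow (p := 2) (by norm_num)
          (show lp (fun _ : G => ℂ) 2 from u) T
        simp only [ENNReal.toReal_ofNat, Real.rpow_ofNat] at h
        simp only [one_mul]
        exact h

/-- The adjacency operator acting on `ℓ²(G)` by `(W u)_i = ∑_j W_{ij} u_j`. -/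
def op : ell2 G →L[ℂ] ell2 G :=
  LinearMap.mkContinuous
    { toFun := fun u => ⟨fun i => ∑' j, (Γ.W i j : ℂ) * u j,
        memℓp_gen' (C := ‖u‖ ^ 2) fun s => by simpa using Γ.sum_norm_row_sq_le u s⟩
      map_add' := fun u v => by
        ext i
        change ∑' j, (Γ.W i j : ℂ) * (u + v) j
          = ∑' j, (Γ.W i j : ℂ) * u j + ∑' j, (Γ.W i j : ℂ) * v j
        rw [tsum_row, tsum_row, tsum_row, ← Finset.sum_add_distrib]
        exact Finset.sum_congr rfl fun j _ => by rw [add_apply, mul_add]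
      map_smul' := fun c u => by
        ext i
        change ∑' j, (Γ.W i j : ℂ) * (c • u) j = c * ∑' j, (Γ.W i j : ℂ) * u j
        rw [tsum_row, tsum_row, Finset.mul_sum]
        exact Finset.sum_congr rfl fun j _ => by rw [smul_apply]; ring }
    1 fun u => by
      refine lp.norm_le_of_forall_sum_le (by norm_num) (by positivity) fun s => ?_
      simp only [ENNReal.toReal_ofNat, Real.rpow_ofNat, one_mul]
      exact Γ.sum_norm_row_sq_le u s

@[simp]
lemma op_apply (u : ell2 G) (i : G) : Γ.op u i = ∑' j, (Γ.W i j : ℂ) * u j := rfl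

lemma op_delta (i j : G) : Γ.op (delta j) i = (Γ.W i j : ℂ) := by
  classical
  rw [op_apply, tsum_eq_single j]
  · simp [delta]
  · intro k hk
    simp [delta, hk]

lemma isSelfAdjoint_op : IsSelfAdjoint Γ.op := by
  classical
  rw [ContinuousLinearMap.isSelfAdjoint_iff']
  ext v i
  have hδ : Γ.op (delta i)
      = ∑ j ∈ (Γ.finite_neighbors i).toFinset, (Γ.W i j : ℂ) • delta j := by
    ext k
    rw [op_delta, ← inner_delta, inner_sum]
    simp only [inner_smul_right, inner_delta, delta_apply]
    simp [Γ.symm k i]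
  rw [← inner_delta, ContinuousLinearMap.adjoint_inner_right, hδ, sum_inner, op_apply, tsum_row]
  refine Finset.sum_congr rfl fun j _ => ?_
  rw [inner_smul_left, inner_delta, Complex.conj_ofReal]

/-- The spectrum `Sp(W)`, as a set of real numbers. -/
abbrev sp : Set ℝ := spectrum ℝ Γ.op

/-- The operator `𝒦(f) = f(W) = ∫ f dE`, for `f` continuous on `Sp(W)`. -/
def K (f : ℝ → ℝ) : ell2 G →L[ℂ] ell2 G := cfc f Γ.op

/-- The matrix `𝒦_S(f) = (𝒦(f)_{ij})_{i, j ∈ S}`. Since `W` and `f` are real, `𝒦(f)_{ij}` is a real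
number, and taking the real part loses nothing. -/
def Kmat (f : ℝ → ℝ) (S : Finset G) : Matrix S S ℝ :=
  Matrix.of fun i j => (⟪delta (i : G), Γ.K f (delta (j : G))⟫_ℂ).re

/-- The positive linear functional `f ↦ ⟨f(W) δ_i, δ_i⟩` on continuous functions on `Sp(W)`. -/
def spectralFunctional (i : G) : C_c(Γ.sp, ℝ) →ₚ[ℝ] ℝ :=
  PositiveLinearMap.mk₀
    { toFun := fun f =>
        (⟪delta i, cfcHom Γ.isSelfAdjoint_op f.toContinuousMap (delta i)⟫_ℂ).re
      map_add' := fun f g => by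
        have h : (f + g).toContinuousMap = f.toContinuousMap + g.toContinuousMap := rfl
        rw [h, map_add, _root_.add_apply, inner_add_right, Complex.add_re]
      map_smul' := fun c f => by
        have h : (c • f).toContinuousMap = c • f.toContinuousMap := rfl
        rw [h, map_smul, _root_.smul_apply, RCLike.real_smul_eq_coe_smul (K := ℂ),
          inner_smul_right]
        simp }
    fun f hf => by
      have h : 0 ≤ cfcHom Γ.isSelfAdjoint_op f.toContinuousMap :=
        (cfcHom_nonneg_iff Γ.isSelfAdjoint_op).2 fun x => hf x
      exact ((ContinuousLinearMap.nonneg_iff_isPositive _).1 h).re_inner_nonneg_right _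

/-- The spectral measure `μ_ii(ω) = ⟨E(ω) δ_i, δ_i⟩` of `W` at `δ_i`, where `E` is the resolution of
the identity of `W`: the measure on `Sp(W)` with `∫ f dμ_ii = ⟨f(W) δ_i, δ_i⟩` for continuous `f`. -/
def spectralMeasure (i : G) : Measure Γ.sp := RealRMK.rieszMeasure (Γ.spectralFunctional i)

instance (i : G) : IsFiniteMeasure (Γ.spectralMeasure i) := by
  unfold spectralMeasure
  infer_instance

/-- The measure `μ_ii` represents the functional calculus of `W` at `δ_i`. -/
lemma integral_spectralMeasure (i : G) (f : C(Γ.sp, ℝ)) :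
    ∫ x, f x ∂(Γ.spectralMeasure i)
      = (⟪delta i, cfcHom Γ.isSelfAdjoint_op f (delta i)⟫_ℂ).re :=
  RealRMK.integral_rieszMeasure (Γ.spectralFunctional i)
    ⟨f, HasCompactSupport.of_compactSpace f⟩

/-- The averaged spectral measure `(1/|S|) ∑_{i ∈ S} μ_ii`. -/
def averageSpectralMeasure (S : Finset G) : FiniteMeasure Γ.sp :=
  (S.card : ℝ≥0)⁻¹ • ∑ i ∈ S, ⟨Γ.spectralMeasure i, inferInstance⟩

/-- The size of the boundary of `S`: the number of vertices of `S` with a neighbor outside `S`. -/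
def boundaryCard (S : Finset G) : ℕ := {i | i ∈ S ∧ ∃ j, j ∉ S ∧ Γ.W i j ≠ 0}.ncard

/-- The regularity factor `α(f) = ∑_k |f_k| (k + 1)` of `f(x) = ∑_k f_k x^k`, `x ∈ Sp(W)`. It is
`∞` if `f` has no such expansion; if `Sp(W)` is too small to determine the coefficients, the
infimum over all expansions is taken. -/
def regularityFactor (f : ℝ → ℝ) : ℝ≥0∞ :=
  ⨅ (a : ℕ → ℝ) (_ : ∀ x ∈ Γ.sp, HasSum (fun k => a k * x ^ k) (f x)),
    ∑' k, ENNReal.ofReal |a k| * (k + 1)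

/-- The class `ℱ` of positive analytic functions on the convex hull of `Sp(W)`. -/
def densities : Set (ℝ → ℝ) :=
  {f | AnalyticOn ℝ f (convexHull ℝ Γ.sp) ∧ ∀ x ∈ convexHull ℝ Γ.sp, 0 < f x}

/-- The class `ℱ_ρ` of those `f ∈ ℱ` with `α(log f) ≤ ρ`. -/
def regularDensities (ρ : ℝ) : Set (ℝ → ℝ) :=
  {f | f ∈ Γ.densities ∧ Γ.regularityFactor (fun x => Real.log (f x)) ≤ ENNReal.ofReal ρ}

end WeightedGraph
end

/-!
In an eigenbasis of the compression of `B = g(W)` to the vectors supported in `G_n`, comparing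
`log det` with the trace of the compression of `log B` is Jensen's inequality for the spectral
measures of `B` at the eigenvectors. The error is controlled by their variances, whose sum is the
squared Hilbert–Schmidt norm of the off-diagonal block of `B`. The operators for which this norm is
`o(m_n)` form a norm closed algebra. It contains `W`, because only boundary vertices contribute and
`‖W‖ ≤ 1`, hence it contains `g(W)`. Finally `tr 𝒦_n(log g) / m_n` is the integral of `log g`
against the average of the spectral measures `μ_ii`, `i ∈ G_n`.
-/

section HilbertSchmidt

variable {𝕜 E F F' ι : Type*} [RCLike 𝕜] [NormedAddCommGroup E] [InnerProductSpace 𝕜 E]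
  [FiniteDimensional 𝕜 E] [NormedAddCommGroup F] [InnerProductSpace 𝕜 F] [CompleteSpace F]
  [NormedAddCommGroup F'] [InnerProductSpace 𝕜 F'] [CompleteSpace F'] [Fintype ι]

open ContinuousLinearMap in
/-- The squared Hilbert–Schmidt norm `tr (T* T)` of an operator with finite-dimensional domain. -/
noncomputable def hilbertSchmidtNormSq (T : E →L[𝕜] F) : ℝ :=
  haveI := FiniteDimensional.complete 𝕜 E
  RCLike.re (LinearMap.trace 𝕜 E (adjoint T ∘L T))

lemma hilbertSchmidtNormSq_eq_sum (T : E →L[𝕜] F) (b : OrthonormalBasis ι 𝕜 E) :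
    hilbertSchmidtNormSq T = ∑ i, ‖T (b i)‖ ^ 2 := by
  have := FiniteDimensional.complete 𝕜 E
  rw [hilbertSchmidtNormSq, LinearMap.trace_eq_sum_inner _ b, map_sum]
  exact Finset.sum_congr rfl fun i _ => T.apply_norm_sq_eq_inner_adjoint_right (b i) |>.symm

lemma hilbertSchmidtNormSq_nonneg (T : E →L[𝕜] F) : 0 ≤ hilbertSchmidtNormSq T := by
  rw [hilbertSchmidtNormSq_eq_sum T (stdOrthonormalBasis 𝕜 E)]
  positivity

lemma hilbertSchmidtNormSq_add_le (S T : E →L[𝕜] F) :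
    hilbertSchmidtNormSq (S + T) ≤ 2 * (hilbertSchmidtNormSq S + hilbertSchmidtNormSq T) := by
  simp only [hilbertSchmidtNormSq_eq_sum _ (stdOrthonormalBasis 𝕜 E), ← Finset.sum_add_distrib,
    Finset.mul_sum]
  gcongr with i
  exact (pow_le_pow_left₀ (norm_nonneg _) (norm_add_le _ _) 2).trans add_sq_le

lemma hilbertSchmidtNormSq_le_opNorm_sq_mul_finrank (T : E →L[𝕜] F) :
    hilbertSchmidtNormSq T ≤ ‖T‖ ^ 2 * Module.finrank 𝕜 E := by
  rw [hilbertSchmidtNormSq_eq_sum T (stdOrthonormalBasis 𝕜 E), mul_comm, ← nsmul_eq_mul]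
  refine (Finset.sum_le_card_nsmul _ _ (‖T‖ ^ 2) fun i _ => ?_).trans_eq (by simp)
  gcongr
  exact T.unit_le_opNorm _ (by simp)

lemma hilbertSchmidtNormSq_comp_le_opNorm_sq_mul (T : F →L[𝕜] F') (S : E →L[𝕜] F) :
    hilbertSchmidtNormSq (T ∘L S) ≤ ‖T‖ ^ 2 * hilbertSchmidtNormSq S := by
  simp only [hilbertSchmidtNormSq_eq_sum _ (stdOrthonormalBasis 𝕜 E), Finset.mul_sum, ← mul_pow]
  gcongr with i
  exact T.le_opNorm _

open ContinuousLinearMap in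
/-- Cyclicity of the trace moves `S` next to `S*`; then evaluate in an eigenbasis of `S S*`. -/
lemma hilbertSchmidtNormSq_comp_le_mul_opNorm_sq {E' : Type*} [NormedAddCommGroup E']
    [InnerProductSpace 𝕜 E'] [FiniteDimensional 𝕜 E'] (T : E →L[𝕜] F) (S : E' →L[𝕜] E) :
    hilbertSchmidtNormSq (T ∘L S) ≤ hilbertSchmidtNormSq T * ‖S‖ ^ 2 := by
  have := FiniteDimensional.complete 𝕜 E
  have := FiniteDimensional.complete 𝕜 E'
  have hsymm : ((S ∘L adjoint S : E →L[𝕜] E) : E →ₗ[𝕜] E).IsSymmetric :=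
    (isPositive_self_comp_adjoint S).isSymmetric
  set b := hsymm.eigenvectorBasis rfl
  have heigen (l) : S (adjoint S (b l)) = (hsymm.eigenvalues rfl l : 𝕜) • b l :=
    hsymm.apply_eigenvectorBasis rfl l
  have hle (l) : hsymm.eigenvalues rfl l ≤ ‖S‖ ^ 2 := by
    have h := (adjoint S).apply_norm_sq_eq_inner_adjoint_right (b l)
    rw [adjoint_adjoint, comp_apply, heigen, inner_smul_right, inner_self_eq_norm_sq_to_K,
      b.norm_eq_one] at h
    have := (adjoint S).unit_le_opNorm (b l) (by simp)
    rw [LinearIsometryEquiv.norm_map] at this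
    calc hsymm.eigenvalues rfl l = ‖adjoint S (b l)‖ ^ 2 := by simp [h]
      _ ≤ ‖S‖ ^ 2 := by gcongr
  calc hilbertSchmidtNormSq (T ∘L S)
      = RCLike.re (LinearMap.trace 𝕜 E ((adjoint T ∘L T) ∘L (S ∘L adjoint S))) := by
        rw [hilbertSchmidtNormSq, adjoint_comp]
        exact congrArg _ (LinearMap.trace_comp_comm'
          ((adjoint T ∘L T) ∘L S : E' →ₗ[𝕜] E) (adjoint S : E →ₗ[𝕜] E'))
    _ = ∑ l, ‖T (b l)‖ ^ 2 * hsymm.eigenvalues rfl l := by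
        rw [LinearMap.trace_eq_sum_inner _ b, map_sum]
        refine Finset.sum_congr rfl fun l _ => ?_
        rw [T.apply_norm_sq_eq_inner_adjoint_right]
        simp [heigen, inner_smul_right, mul_comm]
    _ ≤ hilbertSchmidtNormSq T * ‖S‖ ^ 2 := by
        rw [hilbertSchmidtNormSq_eq_sum T b, Finset.sum_mul]
        gcongr with l
        exact hle l

end HilbertSchmidt

section Leakage

variable {𝕜 E ι : Type*} [RCLike 𝕜] [NormedAddCommGroup E] [InnerProductSpace 𝕜 E]

/-- The compression `P T|_U` of an operator to a subspace `U` with orthogonal projection `P`. -/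
noncomputable def compression (U : Submodule 𝕜 E) [U.HasOrthogonalProjection] (T : E →L[𝕜] E) :
    U →L[𝕜] U :=
  U.orthogonalProjectionOnto ∘L T ∘L U.subtypeL

lemma coe_compression_apply (U : Submodule 𝕜 E) [U.HasOrthogonalProjection] (T : E →L[𝕜] E)
    (x : U) : (compression U T x : E) = U.starProjection (T x) := rfl

lemma inner_compression_apply (U : Submodule 𝕜 E) [U.HasOrthogonalProjection] (T : E →L[𝕜] E)
    (x y : U) : ⟪x, compression U T y⟫_𝕜 = ⟪(x : E), T y⟫_𝕜 := by
  rw [compression, ContinuousLinearMap.comp_apply,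
    Submodule.inner_orthogonalProjectionOnto_eq_of_mem_left]
  rfl

lemma isSymmetric_compression (U : Submodule 𝕜 E) [U.HasOrthogonalProjection] {T : E →L[𝕜] E}
    (hT : (T : E →ₗ[𝕜] E).IsSymmetric) : (compression U T : U →ₗ[𝕜] U).IsSymmetric := fun x y => by
  rw [ContinuousLinearMap.coe_coe, inner_compression_apply, ← inner_conj_symm,
    inner_compression_apply, inner_conj_symm]
  exact hT x y

lemma starProjection_orthogonal_apply_of_compression_eq_smul {U : Submodule 𝕜 E}
    [U.HasOrthogonalProjection] {T : E →L[𝕜] E} {x : U} {c : 𝕜}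
    (hx : compression U T x = c • x) : Uᗮ.starProjection (T x) = T x - c • (x : E) := by
  rw [Submodule.starProjection_orthogonal', _root_.sub_apply, ← coe_compression_apply, hx]
  rfl

lemma opNorm_compression_le (U : Submodule 𝕜 E) [U.HasOrthogonalProjection] (T : E →L[𝕜] E) :
    ‖compression U T‖ ≤ ‖T‖ := by
  refine ContinuousLinearMap.opNorm_le_bound _ (norm_nonneg T) fun x => ?_
  exact (U.norm_orthogonalProjectionOnto_apply_le _).trans (T.le_opNorm x)

variable [CompleteSpace E] (U : Submodule 𝕜 E) [FiniteDimensional 𝕜 U]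

/-- The squared Hilbert–Schmidt norm of the block `U → Uᗮ` of an operator. It vanishes exactly when
`U` is invariant, and otherwise measures the failure of invariance. -/
noncomputable def leakage (T : E →L[𝕜] E) : ℝ :=
  hilbertSchmidtNormSq (Uᗮ.starProjection ∘L T ∘L U.subtypeL)

variable {U}

lemma leakage_nonneg (T : E →L[𝕜] E) : 0 ≤ leakage U T := hilbertSchmidtNormSq_nonneg _

lemma leakage_eq_sum [Fintype ι] (b : OrthonormalBasis ι 𝕜 U) (T : E →L[𝕜] E) :
    leakage U T = ∑ i, ‖Uᗮ.starProjection (T (b i))‖ ^ 2 :=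
  hilbertSchmidtNormSq_eq_sum _ b

lemma leakage_add_le (S T : E →L[𝕜] E) :
    leakage U (S + T) ≤ 2 * (leakage U S + leakage U T) := by
  simp only [leakage, ContinuousLinearMap.add_comp, ContinuousLinearMap.comp_add]
  exact hilbertSchmidtNormSq_add_le _ _

lemma leakage_eq_zero_of_mapsTo {T : E →L[𝕜] E} (hT : ∀ x ∈ U, T x ∈ U) : leakage U T = 0 := by
  rw [leakage_eq_sum (stdOrthonormalBasis 𝕜 U)]
  refine Finset.sum_eq_zero fun i _ => ?_
  rw [Submodule.starProjection_orthogonal_apply_eq_zero (hT _ (Subtype.property _)), norm_zero,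
    zero_pow two_ne_zero]

lemma leakage_le_opNorm_sq_mul_finrank (T : E →L[𝕜] E) :
    leakage U T ≤ ‖T‖ ^ 2 * Module.finrank 𝕜 U := by
  refine (hilbertSchmidtNormSq_le_opNorm_sq_mul_finrank _).trans ?_
  gcongr
  refine ContinuousLinearMap.opNorm_le_bound _ (norm_nonneg T) fun x => ?_
  exact (Uᗮ.norm_starProjection_apply_le _).trans (T.le_opNorm x)

lemma leakage_mul_le (S T : E →L[𝕜] E) :
    leakage U (S * T) ≤ 2 * (leakage U S * ‖T‖ ^ 2 + ‖S‖ ^ 2 * leakage U T) := by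
  have hsplit : Uᗮ.starProjection ∘L (S * T) ∘L U.subtypeL
      = (Uᗮ.starProjection ∘L S ∘L U.subtypeL) ∘L compression U T
        + (Uᗮ.starProjection ∘L S) ∘L (Uᗮ.starProjection ∘L T ∘L U.subtypeL) := by
    ext x
    simp only [Submodule.starProjection_orthogonal, ContinuousLinearMap.comp_apply,
      _root_.add_apply, _root_.sub_apply, ContinuousLinearMap.id_apply,
      Submodule.subtypeL_apply, coe_compression_apply, map_sub, mul_apply_eq_comp]
    abel
  have hS : ‖Uᗮ.starProjection ∘L S‖ ≤ ‖S‖ :=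
    (ContinuousLinearMap.opNorm_comp_le _ _).trans
      (mul_le_of_le_one_left (norm_nonneg S) Uᗮ.starProjection_norm_le)
  calc leakage U (S * T)
      ≤ 2 * (hilbertSchmidtNormSq
            ((Uᗮ.starProjection ∘L S ∘L U.subtypeL) ∘L compression U T)
          + hilbertSchmidtNormSq
            ((Uᗮ.starProjection ∘L S) ∘L (Uᗮ.starProjection ∘L T ∘L U.subtypeL))) := by
        rw [leakage, hsplit]
        exact hilbertSchmidtNormSq_add_le _ _
    _ ≤ 2 * (leakage U S * ‖compression U T‖ ^ 2
          + ‖Uᗮ.starProjection ∘L S‖ ^ 2 * leakage U T) := by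
        gcongr
        · exact hilbertSchmidtNormSq_comp_le_mul_opNorm_sq _ _
        · exact hilbertSchmidtNormSq_comp_le_opNorm_sq_mul _ _
    _ ≤ 2 * (leakage U S * ‖T‖ ^ 2 + ‖S‖ ^ 2 * leakage U T) := by
        gcongr
        · exact leakage_nonneg S
        · exact opNorm_compression_le U T
        · exact leakage_nonneg T

end Leakage

section AlmostInvariant

open Asymptotics

variable {𝕜 E κ : Type*} [RCLike 𝕜] [NormedAddCommGroup E] [InnerProductSpace 𝕜 E]
  [CompleteSpace E] (l : Filter κ) (U : κ → Submodule 𝕜 E) [∀ n, FiniteDimensional 𝕜 (U n)]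

/-- The algebra of operators `T` under which the subspaces `U n`, with orthogonal projections `P n`,
are asymptotically invariant along `l` in normalized Hilbert–Schmidt norm:
`‖(1 - P n) T (P n)‖² = o(dim (U n))`. -/
noncomputable def almostInvariant : Subalgebra 𝕜 (E →L[𝕜] E) where
  carrier := {T | (fun n => leakage (U n) T) =o[l] fun n => (Module.finrank 𝕜 (U n) : ℝ)}
  mul_mem' {S T} hS hT := by
    refine IsBigO.trans_isLittleO (.of_norm_le fun n => ?_)
      (((hS.const_mul_left (‖T‖ ^ 2)).add (hT.const_mul_left (‖S‖ ^ 2))).const_mul_left 2)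
    rw [Real.norm_of_nonneg (leakage_nonneg _), mul_comm (‖T‖ ^ 2)]
    exact leakage_mul_le S T
  add_mem' {S T} hS hT := by
    refine IsBigO.trans_isLittleO (.of_norm_le fun n => ?_) ((hS.add hT).const_mul_left 2)
    rw [Real.norm_of_nonneg (leakage_nonneg _)]
    exact leakage_add_le S T
  algebraMap_mem' c := by
    refine (isLittleO_zero _ _).congr_left fun n => ?_
    exact (leakage_eq_zero_of_mapsTo fun x hx => by simpa using (U n).smul_mem c hx).symm

variable {l U}

lemma mem_almostInvariant {T : E →L[𝕜] E} : T ∈ almostInvariant l U ↔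
    (fun n => leakage (U n) T) =o[l] fun n => (Module.finrank 𝕜 (U n) : ℝ) := Iff.rfl

lemma isClosed_almostInvariant : IsClosed (almostInvariant l U : Set (E →L[𝕜] E)) := by
  refine isClosed_of_closure_subset fun T hT => isLittleO_iff.2 fun ε hε => ?_
  obtain ⟨S, hS, hTS⟩ := Metric.mem_closure_iff.1 hT (√(ε / 4)) (by positivity)
  filter_upwards [isLittleO_iff.1 hS (show 0 < ε / 4 by positivity)] with n hn
  rw [dist_eq_norm] at hTS
  rw [Real.norm_of_nonneg (leakage_nonneg _), Real.norm_natCast] at hn ⊢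
  calc leakage (U n) T ≤ 2 * (leakage (U n) (T - S) + leakage (U n) S) := by
        simpa using leakage_add_le (U := U n) (T - S) S
    _ ≤ 2 * (√(ε / 4) ^ 2 * Module.finrank 𝕜 (U n) + ε / 4 * Module.finrank 𝕜 (U n)) := by
        gcongr
        refine (leakage_le_opNorm_sq_mul_finrank _).trans ?_
        gcongr
    _ = ε * Module.finrank 𝕜 (U n) := by
        rw [Real.sq_sqrt (by positivity)]
        ring

end AlmostInvariant

section FunctionalCalculus

variable {A : Type*} [CStarAlgebra A] {a : A}

lemma cfc_mem_algebraElemental (ha : IsSelfAdjoint a) (f : ℝ → ℝ) :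
    cfc f a ∈ Algebra.elemental ℝ a := by
  have h : (StarAlgebra.elemental ℝ a).toSubalgebra = Algebra.elemental ℝ a := by
    refine SetLike.coe_injective ?_
    simp only [StarAlgebra.elemental, Algebra.elemental, StarSubalgebra.coe_toSubalgebra,
      StarSubalgebra.topologicalClosure_coe, Subalgebra.topologicalClosure_coe]
    rw [← StarSubalgebra.coe_toSubalgebra, StarAlgebra.adjoin_toSubalgebra, Set.star_singleton,
      ha.star_eq, Set.union_self]
  rw [← h]
  exact cfc_mem_elemental f a

lemma cfc_mem_of_isClosed {S : Subalgebra ℝ A} (hS : IsClosed (S : Set A)) (ha : IsSelfAdjoint a)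
    (haS : a ∈ S) (f : ℝ → ℝ) : cfc f a ∈ S :=
  Algebra.elemental.le_of_mem hS haS (cfc_mem_algebraElemental ha f)

lemma log_cfc {f : ℝ → ℝ} (ha : IsSelfAdjoint a) (hf : ContinuousOn f (spectrum ℝ a))
    (hf0 : ∀ y ∈ spectrum ℝ a, f y ≠ 0) : CFC.log (cfc f a) = cfc (fun y => Real.log (f y)) a := by
  have hlog : ContinuousOn Real.log (f '' spectrum ℝ a) :=
    Real.continuousOn_log.mono (by rintro _ ⟨y, hy, rfl⟩; exact hf0 y hy)
  exact (cfc_comp' Real.log f a hlog hf).symm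

end FunctionalCalculus

section InvariantSubspace

/-- The algebra of complex-linear operators mapping a real subspace `P` into itself. -/
def realInvariant {E : Type*} [NormedAddCommGroup E] [NormedSpace ℂ E] (P : Submodule ℝ E) :
    Subalgebra ℝ (E →L[ℂ] E) where
  carrier := {T | ∀ x ∈ P, T x ∈ P}
  mul_mem' hS hT x hx := hS _ (hT x hx)
  add_mem' hS hT x hx := P.add_mem (hS x hx) (hT x hx)
  algebraMap_mem' c x hx := by simpa [Algebra.algebraMap_eq_smul_one] using P.smul_mem c hx

lemma isClosed_realInvariant {E : Type*} [NormedAddCommGroup E] [NormedSpace ℂ E]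
    {P : Submodule ℝ E} (hP : IsClosed (P : Set E)) :
    IsClosed (realInvariant P : Set (E →L[ℂ] E)) := by
  change IsClosed {T : E →L[ℂ] E | ∀ x ∈ P, T x ∈ P}
  simp only [Set.ofPred_forall]
  exact isClosed_biInter fun x _ => hP.preimage (by fun_prop)

end InvariantSubspace

section Logarithm

lemma log_le_log_add_inv_mul_sub {t y : ℝ} (ht : 0 < t) (hy : 0 < y) :
    Real.log y ≤ Real.log t + t⁻¹ * (y - t) := by
  have h := Real.log_le_sub_one_of_pos (div_pos hy ht)
  rw [Real.log_div hy.ne' ht.ne'] at h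
  calc Real.log y ≤ Real.log t + (y / t - 1) := by linarith
    _ = Real.log t + t⁻¹ * (y - t) := by field_simp

lemma log_add_inv_mul_sub_sub_le_log {c t y : ℝ} (hc : 0 < c) (ht : c ≤ t) (hy : c ≤ y) :
    Real.log t + t⁻¹ * (y - t) - (c ^ 2)⁻¹ * (y - t) ^ 2 ≤ Real.log y := by
  have ht0 := hc.trans_le ht
  have hy0 := hc.trans_le hy
  have h := log_le_log_add_inv_mul_sub hy0 ht0
  have hle : (t * y)⁻¹ ≤ (c ^ 2)⁻¹ := by
    rw [sq]
    gcongr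
  calc Real.log t + t⁻¹ * (y - t) - (c ^ 2)⁻¹ * (y - t) ^ 2
      ≤ Real.log t + t⁻¹ * (y - t) - (t * y)⁻¹ * (y - t) ^ 2 := by gcongr
    _ = Real.log t - y⁻¹ * (t - y) := by field_simp; ring
    _ ≤ Real.log y := by linarith

end Logarithm

section Jensen

variable {H : Type*} [NormedAddCommGroup H] [InnerProductSpace ℂ H]

lemma re_inner_le_re_inner_of_le {S T : H →L[ℂ] H} (h : S ≤ T) (x : H) :
    (⟪x, S x⟫_ℂ).re ≤ (⟪x, T x⟫_ℂ).re := by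
  have := ((ContinuousLinearMap.le_def _ _).1 h).re_inner_nonneg_right x
  simpa [inner_sub_right] using this

variable [CompleteSpace H] {B : H →L[ℂ] H}

lemma le_re_inner_of_le_spectrum (hB : IsSelfAdjoint B) {c : ℝ}
    (hc : ∀ y ∈ spectrum ℝ B, c ≤ y) {x : H} (hx : ‖x‖ = 1) : c ≤ (⟪x, B x⟫_ℂ).re := by
  have h := re_inner_le_re_inner_of_le (algebraMap_le_of_le_spectrum hc) x
  simpa [Algebra.algebraMap_eq_smul_one, inner_smul_right_eq_smul, inner_self_eq_norm_sq_to_K, hx]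
    using h

lemma re_inner_cfc_quadratic (hB : IsSelfAdjoint B) {x : H} (hx : ‖x‖ = 1) {t : ℝ}
    (ht : t = (⟪x, B x⟫_ℂ).re) (a b d : ℝ) :
    (⟪x, cfc (fun y => a + b * (y - t) + d * (y - t) ^ 2) B x⟫_ℂ).re
      = a + d * ‖B x - t • x‖ ^ 2 := by
  set C := B - algebraMap ℝ (H →L[ℂ] H) t with hC
  have hCsa : IsSelfAdjoint C := hB.sub (.algebraMap _ (.all t))
  have hcfc : cfc (fun y => a + b * (y - t) + d * (y - t) ^ 2) B
      = algebraMap ℝ _ a + b • C + d • C ^ 2 := by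
    rw [cfc_add .., cfc_const_add .., cfc_const_mul .., cfc_const_mul .., cfc_pow .., cfc_sub ..,
      cfc_id' ℝ B, cfc_const ..]
  have hCx : C x = B x - t • x := by simp [hC, Algebra.algebraMap_eq_smul_one]
  have hlin : (⟪x, C x⟫_ℂ).re = 0 := by
    rw [hCx, inner_sub_right, Complex.sub_re, ← ht]
    simp [inner_smul_right_eq_smul, inner_self_eq_norm_sq_to_K, hx]
  have hsq : ⟪x, C (C x)⟫_ℂ = ‖C x‖ ^ 2 := by
    rw [← hCsa.isSymmetric.apply_clm x, inner_self_eq_norm_sq_to_K]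
    rfl
  rw [hcfc]
  simp [Algebra.algebraMap_eq_smul_one, inner_smul_right_eq_smul,
    inner_self_eq_norm_sq_to_K, hx, hlin, hsq, sq C, ← hCx, ← Complex.ofReal_pow]

lemma abs_log_re_inner_sub_re_inner_log_le (hB : IsSelfAdjoint B) {c : ℝ} (hc : 0 < c)
    (hcB : ∀ y ∈ spectrum ℝ B, c ≤ y) {x : H} (hx : ‖x‖ = 1) :
    |Real.log (⟪x, B x⟫_ℂ).re - (⟪x, CFC.log B x⟫_ℂ).re|
      ≤ (c ^ 2)⁻¹ * ‖B x - (⟪x, B x⟫_ℂ).re • x‖ ^ 2 := by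
  set t := (⟪x, B x⟫_ℂ).re with ht
  have hct : c ≤ t := le_re_inner_of_le_spectrum hB hcB hx
  have hlog : ContinuousOn Real.log (spectrum ℝ B) :=
    Real.continuousOn_log.mono fun y hy => (hc.trans_le (hcB y hy)).ne'
  have hup := re_inner_le_re_inner_of_le (cfc_mono (a := B) (f := Real.log)
    (g := fun y => Real.log t + t⁻¹ * (y - t) + 0 * (y - t) ^ 2) (fun y hy => by
      simpa using log_le_log_add_inv_mul_sub (hc.trans_le hct) (hc.trans_le (hcB y hy)))) x
  have hlow := re_inner_le_re_inner_of_le (cfc_mono (a := B) (g := Real.log)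
    (f := fun y => Real.log t + t⁻¹ * (y - t) + -(c ^ 2)⁻¹ * (y - t) ^ 2) (fun y hy => by
      simpa [← sub_eq_add_neg] using log_add_inv_mul_sub_sub_le_log hc hct (hcB y hy))) x
  rw [re_inner_cfc_quadratic hB hx ht] at hup hlow
  rw [CFC.log, abs_le]
  have : 0 ≤ (c ^ 2)⁻¹ * ‖B x - t • x‖ ^ 2 := by positivity
  constructor <;> linarith

end Jensen

section CompressionDet

open scoped ComplexOrder

variable {H : Type*} [NormedAddCommGroup H] [InnerProductSpace ℂ H] [CompleteSpace H]
  {B : H →L[ℂ] H} (U : Submodule ℂ H) [FiniteDimensional ℂ U]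

lemma exists_orthonormalBasis_compression (hB : IsSelfAdjoint B) :
    ∃ b : OrthonormalBasis (Fin (Module.finrank ℂ U)) ℂ U,
      (compression U B).det = ∏ l, ((⟪(b l : H), B (b l)⟫_ℂ).re : ℂ) ∧
      ∀ l, Uᗮ.starProjection (B (b l)) = B (b l) - (⟪(b l : H), B (b l)⟫_ℂ).re • (b l : H) := by
  have hsymm := isSymmetric_compression U hB.isSymmetric
  have heigen (l) : compression U B (hsymm.eigenvectorBasis rfl l)
      = (hsymm.eigenvalues rfl l : ℂ) • hsymm.eigenvectorBasis rfl l :=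
    hsymm.apply_eigenvectorBasis rfl l
  have hvalue (l) : hsymm.eigenvalues rfl l
      = (⟪(hsymm.eigenvectorBasis rfl l : H), B (hsymm.eigenvectorBasis rfl l)⟫_ℂ).re := by
    rw [← inner_compression_apply, heigen, inner_smul_right]
    simp
  refine ⟨hsymm.eigenvectorBasis rfl, ?_, fun l => ?_⟩
  · simp only [← hvalue]
    exact hsymm.det_eq_prod_eigenvalues rfl
  · rw [← hvalue]
    exact starProjection_orthogonal_apply_of_compression_eq_smul (heigen l)

variable {U}

lemma det_compression_pos (hB : IsSelfAdjoint B) (hB0 : ∀ y ∈ spectrum ℝ B, 0 < y) :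
    0 < (compression U B).det := by
  obtain ⟨c, hc, hcB⟩ := (spectrum.isCompact B).exists_forall_le' continuousOn_id hB0
  obtain ⟨b, hdet, -⟩ := exists_orthonormalBasis_compression U hB
  rw [hdet]
  refine Finset.prod_pos fun l _ => Complex.zero_lt_real.2 ?_
  exact hc.trans_le (le_re_inner_of_le_spectrum hB hcB (b.norm_eq_one l))

/-- In an eigenbasis of the compression the claim is Jensen's inequality with variance term, and
the variance of `B` at an eigenvector of its compression is what `B` moves out of `U`. -/
lemma abs_log_norm_det_compression_sub_trace_le (hB : IsSelfAdjoint B) {c : ℝ} (hc : 0 < c)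
    (hcB : ∀ y ∈ spectrum ℝ B, c ≤ y) :
    |Real.log ‖(compression U B).det‖ - (LinearMap.trace ℂ U (compression U (CFC.log B))).re|
      ≤ (c ^ 2)⁻¹ * leakage U B := by
  obtain ⟨b, hdet, hb⟩ := exists_orthonormalBasis_compression U hB
  have hb1 (l) : ‖(b l : H)‖ = 1 := b.norm_eq_one l
  have hpos (l) : 0 < (⟪(b l : H), B (b l)⟫_ℂ).re :=
    hc.trans_le (le_re_inner_of_le_spectrum hB hcB (hb1 l))
  have hlog : Real.log ‖(compression U B).det‖ = ∑ l, Real.log (⟪(b l : H), B (b l)⟫_ℂ).re := by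
    rw [hdet, norm_prod, Real.log_prod fun l _ => by simpa using (hpos l).ne']
    simp
  have htrace : (LinearMap.trace ℂ U (compression U (CFC.log B))).re
      = ∑ l, (⟪(b l : H), CFC.log B (b l)⟫_ℂ).re := by
    rw [LinearMap.trace_eq_sum_inner _ b, Complex.re_sum]
    exact Finset.sum_congr rfl fun l _ => congrArg _ (inner_compression_apply U _ _ _)
  rw [hlog, htrace, ← Finset.sum_sub_distrib, leakage_eq_sum b, Finset.mul_sum]
  refine (Finset.abs_sum_le_sum_abs _ _).trans (Finset.sum_le_sum fun l _ => ?_)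
  rw [hb]
  exact abs_log_re_inner_sub_re_inner_log_le hB hc hcB (hb1 l)

lemma isLittleO_log_norm_det_compression_sub_trace {κ : Type*} {l : Filter κ}
    {U : κ → Submodule ℂ H} [∀ n, FiniteDimensional ℂ (U n)] (hB : IsSelfAdjoint B)
    (hB0 : ∀ y ∈ spectrum ℝ B, 0 < y) (hBU : B ∈ almostInvariant l U) :
    (fun n => Real.log ‖(compression (U n) B).det‖
        - (LinearMap.trace ℂ (U n) (compression (U n) (CFC.log B))).re)
      =o[l] fun n => (Module.finrank ℂ (U n) : ℝ) := by
  obtain ⟨c, hc, hcB⟩ := (spectrum.isCompact B).exists_forall_le' continuousOn_id hB0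
  refine Asymptotics.IsBigO.trans_isLittleO (.of_norm_le fun n => ?_)
    ((mem_almostInvariant.1 hBU).const_mul_left (c ^ 2)⁻¹)
  exact abs_log_norm_det_compression_sub_trace_le hB hc hcB

end CompressionDet

namespace ell2

variable {G : Type*}

lemma orthonormal_delta : Orthonormal ℂ (delta : G → ell2 G) := by
  classical
  rw [orthonormal_iff_ite]
  intro i j
  rw [inner_delta, delta_apply]

/-- The space of vectors supported in the finite set `S`. -/
noncomputable def supportedIn (S : Finset G) : Submodule ℂ (ell2 G) :=
  open Classical in Submodule.span ℂ (S.image delta : Set (ell2 G))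

/-- The orthonormal basis `(δ_i)_{i ∈ S}` of the space of vectors supported in `S`. -/
noncomputable def deltaBasis (S : Finset G) : OrthonormalBasis S ℂ (supportedIn S) :=
  open Classical in OrthonormalBasis.span orthonormal_delta S

lemma coe_deltaBasis (S : Finset G) (i : S) : (deltaBasis S i : ell2 G) = delta (i : G) := by
  classical exact OrthonormalBasis.span_apply orthonormal_delta S i

instance (S : Finset G) : FiniteDimensional ℂ (supportedIn S) :=
  (deltaBasis S).toBasis.finiteDimensional_of_finite

lemma finrank_supportedIn (S : Finset G) : Module.finrank ℂ (supportedIn S) = S.card := by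
  simp [Module.finrank_eq_card_basis (deltaBasis S).toBasis]

lemma delta_mem_supportedIn {S : Finset G} {i : G} (hi : i ∈ S) : delta i ∈ supportedIn S :=
  coe_deltaBasis S ⟨i, hi⟩ ▸ (deltaBasis S ⟨i, hi⟩).2

/-- The real subspace of families with real entries. -/
def realVectors (G : Type*) : Submodule ℝ (ell2 G) where
  carrier := {u | ∀ i, (u i).im = 0}
  zero_mem' i := by simp [← inner_delta]
  add_mem' hu hv i := by simp [add_apply, hu i, hv i]
  smul_mem' c u hu i := by
    simp only [← inner_delta, inner_smul_right_eq_smul, Complex.smul_im] at hu ⊢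
    simp [hu i]

lemma isClosed_realVectors : IsClosed (realVectors G : Set (ell2 G)) := by
  change IsClosed {u : ell2 G | ∀ i, (u i).im = 0}
  simp only [Set.ofPred_forall, ← inner_delta]
  exact isClosed_iInter fun i => isClosed_eq (by fun_prop) continuous_const

lemma delta_mem_realVectors (i : G) : delta i ∈ realVectors G := fun j => by
  classical
  rw [delta_apply]
  split_ifs <;> simp

end ell2

open ell2

namespace WeightedGraph

variable {G : Type*} (Γ : WeightedGraph G)

lemma norm_op_le_one : ‖Γ.op‖ ≤ 1 := LinearMap.mkContinuous_norm_le _ zero_le_one _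

lemma op_delta_eq_sum (j : G) :
    Γ.op (delta j) = ∑ i ∈ (Γ.finite_neighbors j).toFinset, (Γ.W j i : ℂ) • delta i := by
  classical
  ext k
  rw [op_delta, ← inner_delta, inner_sum]
  simp only [inner_smul_right, inner_delta, delta_apply]
  simp [Γ.symm j k]

lemma op_delta_mem_supportedIn {S : Finset G} {j : G} (hj : ∀ i, Γ.W j i ≠ 0 → i ∈ S) :
    Γ.op (delta j) ∈ supportedIn S := by
  rw [op_delta_eq_sum]
  exact Submodule.sum_mem _ fun i hi =>
    Submodule.smul_mem _ _ (delta_mem_supportedIn (hj i (by simpa using hi)))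

lemma leakage_op_le_boundaryCard (S : Finset G) :
    leakage (supportedIn S) Γ.op ≤ Γ.boundaryCard S := by
  classical
  have hcard : (Γ.boundaryCard S : ℝ) = ∑ j ∈ S, if ∃ i, i ∉ S ∧ Γ.W j i ≠ 0 then 1 else 0 := by
    rw [Finset.sum_boole, boundaryCard, ← Set.ncard_coe_finset, Finset.coe_filter]
  rw [leakage_eq_sum (deltaBasis S), hcard, ← Finset.sum_coe_sort S]
  refine Finset.sum_le_sum fun j _ => ?_
  rw [coe_deltaBasis]
  split_ifs with h
  · refine pow_le_one₀ (norm_nonneg _) ((Submodule.norm_starProjection_apply_le _ _).trans ?_)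
    exact (Γ.op.le_of_opNorm_le Γ.norm_op_le_one _).trans_eq
      (by rw [orthonormal_delta.1, one_mul])
  · push Not at h
    rw [Submodule.starProjection_orthogonal_apply_eq_zero
      (Γ.op_delta_mem_supportedIn fun i hi => by_contra fun hiS => hi (h i hiS))]
    simp

lemma op_mem_almostInvariant {κ : Type*} {l : Filter κ} {V : κ → Finset G}
    (hV : (fun n => (Γ.boundaryCard (V n) : ℝ)) =o[l] fun n => ((V n).card : ℝ)) :
    Γ.op ∈ almostInvariant l fun n => supportedIn (V n) := by
  simp only [mem_almostInvariant, finrank_supportedIn]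
  refine Asymptotics.IsBigO.trans_isLittleO (.of_norm_le fun n => ?_) hV
  rw [Real.norm_of_nonneg (leakage_nonneg _)]
  exact Γ.leakage_op_le_boundaryCard (V n)

lemma op_mem_realInvariant : Γ.op ∈ realInvariant (realVectors G) := fun u hu i => by
  rw [op_apply, tsum_row, Complex.im_sum]
  exact Finset.sum_eq_zero fun j _ => by simp [hu j]

lemma inner_K_delta (f : ℝ → ℝ) (i j : G) :
    ⟪delta i, Γ.K f (delta j)⟫_ℂ = ((⟪delta i, Γ.K f (delta j)⟫_ℂ).re : ℂ) := by
  have h := cfc_mem_of_isClosed (isClosed_realInvariant isClosed_realVectors) Γ.isSelfAdjoint_op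
    Γ.op_mem_realInvariant f (delta j) (delta_mem_realVectors j) i
  exact Complex.ext rfl (by rw [inner_delta]; exact h)

lemma map_ofReal_Kmat [DecidableEq G] (f : ℝ → ℝ) (S : Finset G) :
    (Γ.Kmat f S).map ((↑) : ℝ → ℂ) = LinearMap.toMatrix (deltaBasis S).toBasis
      (deltaBasis S).toBasis (compression (supportedIn S) (Γ.K f)) := by
  ext i j
  rw [LinearMap.toMatrix_apply, OrthonormalBasis.coe_toBasis_repr_apply,
    OrthonormalBasis.repr_apply_apply, OrthonormalBasis.coe_toBasis, ContinuousLinearMap.coe_coe,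
    inner_compression_apply, coe_deltaBasis, coe_deltaBasis, inner_K_delta]
  rfl

lemma ofReal_det_Kmat [DecidableEq G] (f : ℝ → ℝ) (S : Finset G) :
    ((Γ.Kmat f S).det : ℂ) = (compression (supportedIn S) (Γ.K f)).det := by
  rw [ContinuousLinearMap.det, ← LinearMap.det_toMatrix (deltaBasis S).toBasis, ← map_ofReal_Kmat]
  exact Complex.ofRealHom.map_det _

lemma ofReal_trace_Kmat (f : ℝ → ℝ) (S : Finset G) :
    ((Γ.Kmat f S).trace : ℂ)
      = LinearMap.trace ℂ (supportedIn S) (compression (supportedIn S) (Γ.K f)) := by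
  classical
  rw [LinearMap.trace_eq_matrix_trace ℂ (deltaBasis S).toBasis, ← map_ofReal_Kmat]
  exact AddMonoidHom.map_trace Complex.ofRealHom _

lemma isSelfAdjoint_K (f : ℝ → ℝ) : IsSelfAdjoint (Γ.K f) := cfc_predicate f Γ.op

lemma pos_of_mem_spectrum_K {f : ℝ → ℝ} (hf : ContinuousOn f Γ.sp) (hf0 : ∀ x ∈ Γ.sp, 0 < f x) :
    ∀ y ∈ spectrum ℝ (Γ.K f), 0 < y := by
  rw [K, cfc_map_spectrum f Γ.op Γ.isSelfAdjoint_op hf]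
  exact Set.forall_mem_image.2 hf0

lemma K_mem_almostInvariant {κ : Type*} {l : Filter κ} {V : κ → Finset G}
    (hV : (fun n => (Γ.boundaryCard (V n) : ℝ)) =o[l] fun n => ((V n).card : ℝ)) (f : ℝ → ℝ) :
    Γ.K f ∈ almostInvariant l fun n => supportedIn (V n) :=
  cfc_mem_of_isClosed (S := (almostInvariant l _).restrictScalars ℝ) isClosed_almostInvariant
    Γ.isSelfAdjoint_op (Γ.op_mem_almostInvariant hV) f

lemma integral_averageSpectralMeasure {f : ℝ → ℝ} (hf : ContinuousOn f Γ.sp) (S : Finset G) :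
    ∫ x : Γ.sp, f x ∂(Γ.averageSpectralMeasure S : Measure Γ.sp)
      = (S.card : ℝ)⁻¹ * (Γ.Kmat f S).trace := by
  have hint (i : G) : ∫ x : Γ.sp, f x ∂(Γ.spectralMeasure i)
      = (⟪delta i, Γ.K f (delta i)⟫_ℂ).re := by
    rw [K, cfc_apply f Γ.op Γ.isSelfAdjoint_op hf]
    exact Γ.integral_spectralMeasure i ⟨_, hf.domRestrict⟩
  have hcoe : (Γ.averageSpectralMeasure S : Measure Γ.sp)
      = (S.card : ℝ≥0)⁻¹ • ∑ i ∈ S, Γ.spectralMeasure i := by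
    rw [averageSpectralMeasure, FiniteMeasure.toMeasure_smul]
    exact congrArg _ (FiniteMeasure.toMeasure_sum
      (ν := fun i => (⟨Γ.spectralMeasure i, inferInstance⟩ : FiniteMeasure Γ.sp)))
  have hintegrable (i : G) : Integrable (fun x : Γ.sp => f x) (Γ.spectralMeasure i) :=
    (BoundedContinuousFunction.mkOfCompact ⟨_, hf.domRestrict⟩).integrable _
  rw [hcoe, integral_smul_nnreal_measure, integral_finsetSum_measure fun i _ => hintegrable i]
  simp only [hint]
  rw [← Finset.sum_coe_sort S, NNReal.smul_def, NNReal.coe_inv, NNReal.coe_natCast]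
  rfl

variable [DecidableEq G] {g : ℝ → ℝ}

open scoped ComplexOrder in
lemma det_Kmat_pos (hg : ContinuousOn g Γ.sp) (hg0 : ∀ x ∈ Γ.sp, 0 < g x) (S : Finset G) :
    0 < (Γ.Kmat g S).det := by
  rw [← Complex.zero_lt_real, ofReal_det_Kmat]
  exact det_compression_pos (Γ.isSelfAdjoint_K g) (Γ.pos_of_mem_spectrum_K hg hg0)

lemma isLittleO_log_det_Kmat_sub_trace {κ : Type*} {l : Filter κ} {V : κ → Finset G}
    (hV : (fun n => (Γ.boundaryCard (V n) : ℝ)) =o[l] fun n => ((V n).card : ℝ))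
    (hg : ContinuousOn g Γ.sp) (hg0 : ∀ x ∈ Γ.sp, 0 < g x) :
    (fun n => Real.log (Γ.Kmat g (V n)).det - (Γ.Kmat (fun x => Real.log (g x)) (V n)).trace)
      =o[l] fun n => ((V n).card : ℝ) := by
  have hlog : CFC.log (Γ.K g) = Γ.K fun x => Real.log (g x) :=
    log_cfc Γ.isSelfAdjoint_op hg fun x hx => (hg0 x hx).ne'
  simpa only [finrank_supportedIn, hlog, ← ofReal_det_Kmat, ← ofReal_trace_Kmat, Complex.ofReal_re,
    Complex.norm_real, Real.norm_eq_abs, Real.log_abs]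
    using isLittleO_log_norm_det_compression_sub_trace (Γ.isSelfAdjoint_K g)
      (Γ.pos_of_mem_spectrum_K hg hg0) (Γ.K_mem_almostInvariant hV g)

end WeightedGraph

theorem corollaryc_general {G κ : Type*} [DecidableEq G] (Γ : WeightedGraph G) {l : Filter κ}
    {V : κ → Finset G}
    (hboundary : (fun n => (Γ.boundaryCard (V n) : ℝ)) =o[l] fun n => ((V n).card : ℝ))
    {μ : FiniteMeasure Γ.sp} (hμ : Tendsto (fun n => Γ.averageSpectralMeasure (V n)) l (𝓝 μ))
    {g : ℝ → ℝ} (hg : ContinuousOn g Γ.sp) (hg0 : ∀ x ∈ Γ.sp, 0 < g x) :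
    (∀ n, 0 < (Γ.Kmat g (V n)).det) ∧
      Integrable (fun x : Γ.sp => Real.log (g x)) (μ : Measure Γ.sp) ∧
      Tendsto (fun n => 1 / ((V n).card : ℝ) * Real.log (Γ.Kmat g (V n)).det) l
        (𝓝 (∫ x : Γ.sp, Real.log (g x) ∂(μ : Measure Γ.sp))) := by
  have hlog : ContinuousOn (fun x => Real.log (g x)) Γ.sp := hg.log fun x hx => (hg0 x hx).ne'
  let F : BoundedContinuousFunction Γ.sp ℝ := .mkOfCompact ⟨_, hlog.domRestrict⟩
  refine ⟨fun n => Γ.det_Kmat_pos hg hg0 (V n), F.integrable _, ?_⟩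
  have htrace : Tendsto (fun n => ((V n).card : ℝ)⁻¹ *
      (Γ.Kmat (fun x => Real.log (g x)) (V n)).trace) l
      (𝓝 (∫ x : Γ.sp, Real.log (g x) ∂(μ : Measure Γ.sp))) := by
    simp only [← Γ.integral_averageSpectralMeasure hlog]
    exact FiniteMeasure.tendsto_iff_forall_integral_tendsto.1 hμ F
  have hdiff := (Γ.isLittleO_log_det_Kmat_sub_trace hboundary hg hg0).tendsto_div_nhds_zero
  refine (zero_add (∫ x : Γ.sp, Real.log (g x) ∂(μ : Measure Γ.sp)) ▸ hdiff.add htrace).congr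
    fun n => ?_
  ring

theorem corollaryc {G : Type*} [DecidableEq G] [Countable G] [Infinite G] (Γ : WeightedGraph G)
    (V : ℕ → Finset G) (hV : Monotone V)
    (hboundary : (fun n => (Γ.boundaryCard (V n) : ℝ)) =o[atTop] fun n => ((V n).card : ℝ))
    (μ : FiniteMeasure Γ.sp)
    (hμ : Tendsto (fun n => Γ.averageSpectralMeasure (V n)) atTop (𝓝 μ))
    (ρ : ℝ) (hρ : 0 < ρ) (g : ℝ → ℝ) (hg : g ∈ Γ.regularDensities ρ) :
    (∀ n, 0 < (Γ.Kmat g (V n)).det) ∧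
      Integrable (fun x : Γ.sp => Real.log (g x)) (μ : Measure Γ.sp) ∧
      Tendsto (fun n => 1 / ((V n).card : ℝ) * Real.log (Γ.Kmat g (V n)).det) atTop
        (𝓝 (∫ x : Γ.sp, Real.log (g x) ∂(μ : Measure Γ.sp))) :=
  corollaryc_general Γ hboundary hμ (hg.1.1.continuousOn.mono (subset_convexHull ℝ _))
    fun x hx => hg.1.2 x (subset_convexHull ℝ _ hx)
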